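/- Let $A\in\mathbb{R}^{n\times n}$, $B\in\mathbb{R}^{n\times m}$, $K\in\mathbb{R}^{m\times n}$. Assume that all eigenvalues of $A$ lie in the closed left half of the complex plane, that $(A,B)$ is stabilizable, and that $A+BK$ is Hurwitz. Let $\mathcal G(t)$, $t\ge 0$, be a time-varying weighted digraph on the nodes $1,\dots,N$ with weights $a_{kj}(t)\in\{0\}\cup[w,\gamma]$ for some constants $0<w\le\gamma$ and with $a_{kk}(t)=0$; there is an edge from $k$ to $j$ at time $t$ if and only if $a_{kj}(t)\ge w$. Its Laplacian $L(t)$ has the entries $l_{kk}(t)=\sum_{i}a_{ki}(t)$ and $l_{kj}(t)=-a_{kj}(t)$ for $j\neq k$. Assume that $L$ is piecewise continuous and bounded on $[0,\infty)$ and that the graph is uniformly connected, in the following sense: there are $T>0$, $\delta>0$ and a node $k$ such that, for all $t\ge 0$, every node $j\ne k$ is joined to $k$ by a directed path in the digraph whose edges are the pairs $(p,q)$ that are an edge at some time in $[t,t+T]$ and satisfy $\int_t^{t+T}a_{pq}(\tau)\,d\tau\ge\delta$. Consider the $N$ systems $\dot x_k=Ax_k+Bu_k$ with the dynamic controllers $$\dot\eta_k=(A+BK)\eta_k+\sum_{j=1}^N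 a_{kj}(t)\,(\eta_j-\eta_k+x_k-x_j),\qquad u_k=K\eta_k,\qquad k=1,\dots,N.$$ Then the solutions of this closed loop exponentially synchronize to a solution of $\dot x_0=Ax_0$: there are constants $M>0$ and $\lambda>0$ such that for every $t_0\ge 0$ and every solution $(x,\eta)$ of the closed loop on $[t_0,\infty)$ (continuous, and satisfying the equations at every $t>t_0$ at which $L$ is continuous) there is a solution $x_0$ of $\dot x_0=Ax_0$ with $$\|x_k(t)-x_0(t)\|+\|\eta_k(t)\|\le M e^{-\lambda(t-t_0)}\sum_{j=1}^N\bigl(\|x_j(t_0)-x_0(t_0)\|+\|\eta_j(t_0)\|\bigr)\qquad\text{for all } t\ge t_0,\ k=1,\dots,N,$$ where $\|\cdot\|$ is the Euclidean norm. -/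

import Mathlib

open Set Filter Topology

noncomputable section

/-- All complex eigenvalues of the real square matrix `A` lie in the closed left half-plane. -/
def EigenvaluesInClosedLeftHalfPlane {n : ℕ} (A : Matrix (Fin n) (Fin n) ℝ) : Prop :=
  ∀ μ : ℂ, Module.End.HasEigenvalue (Matrix.toLin' (A.map Complex.ofReal)) μ → μ.re ≤ 0

/-- `A` is Hurwitz: all its complex eigenvalues have negative real part. -/
def IsHurwitz {n : ℕ} (A : Matrix (Fin n) (Fin n) ℝ) : Prop :=
  ∀ μ : ℂ, Module.End.HasEigenvalue (Matrix.toLin' (A.map Complex.ofReal)) μ → μ.re < 0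

/-- The pair `(A, B)` is stabilizable: some linear state feedback makes `A + B F` Hurwitz. -/
def IsStabilizable {n m : ℕ} (A : Matrix (Fin n) (Fin n) ℝ) (B : Matrix (Fin n) (Fin m) ℝ) :
    Prop :=
  ∃ F : Matrix (Fin m) (Fin n) ℝ, IsHurwitz (A + B * F)

/-- A function of time `t ≥ 0` is piecewise continuous: finitely many discontinuities in every
bounded time interval, and one-sided limits everywhere. -/
def PiecewiseContinuous {E : Type*} [TopologicalSpace E] (f : ℝ → E) : Prop :=
  (∀ b : ℝ, {t : ℝ | t ∈ Icc 0 b ∧ ¬ ContinuousWithinAt f (Ici 0) t}.Finite) ∧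
  (∀ t : ℝ, 0 ≤ t → ∃ l : E, Tendsto f (𝓝[>] t) (𝓝 l)) ∧
  (∀ t : ℝ, 0 < t → ∃ l : E, Tendsto f (𝓝[<] t) (𝓝 l))

/-- A time-varying weighted digraph on `N` nodes, at times `t ≥ 0`, without self-loops, whose
weights lie in `{0} ∪ [lo, hi]` for some `0 < lo ≤ hi`. The weight `weight t k j` is positive
when agent `k` receives information from agent `j`. -/
structure CommGraph (N : ℕ) where
  /-- the weighted adjacency matrix at time `t` -/
  weight : ℝ → Matrix (Fin N) (Fin N) ℝ
  /-- lower bound of the nonzero weights -/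
  lo : ℝ
  /-- upper bound of the weights -/
  hi : ℝ
  lo_pos : 0 < lo
  lo_le_hi : lo ≤ hi
  weight_mem : ∀ t : ℝ, 0 ≤ t → ∀ k j, weight t k j = 0 ∨ weight t k j ∈ Icc lo hi
  no_loops : ∀ t : ℝ, 0 ≤ t → ∀ k, weight t k k = 0

namespace CommGraph

variable {N : ℕ}

/-- There is an edge from `k` to `j` at time `t`, i.e. `j` is a neighbor of `k`. -/
def Edge (G : CommGraph N) (t : ℝ) (k j : Fin N) : Prop := G.lo ≤ G.weight t k j

/-- The Laplacian matrix at time `t`. -/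
def laplacian (G : CommGraph N) (t : ℝ) : Matrix (Fin N) (Fin N) ℝ :=
  Matrix.of fun k j => if j = k then ∑ i, G.weight t k i else - G.weight t k j

/-- The edges of the digraph of the time interval `[a, b]`: the pairs that are an edge at some time
of the interval and whose integrated weight over the interval is at least the threshold `δ`. -/
def IntervalEdge (G : CommGraph N) (δ a b : ℝ) (k j : Fin N) : Prop :=
  (∃ t ∈ Icc a b, G.Edge t k j) ∧ δ ≤ ∫ t in a..b, G.weight t k j

/-- Uniform connectivity: there are a horizon `T > 0`, a threshold `δ > 0` and a node `k` such that
for all `t ≥ 0` every other node is joined to `k` by a directed path (each vertex of which is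
followed by a neighbor of it) in the digraph of the interval `[t, t + T]`. -/
def UniformlyConnected (G : CommGraph N) : Prop :=
  ∃ T > 0, ∃ δ > 0, ∃ k : Fin N, ∀ t : ℝ, 0 ≤ t → ∀ j : Fin N, j ≠ k →
    Relation.TransGen (G.IntervalEdge δ t (t + T)) j k

end CommGraph

/-- `(x, η)` is a solution on `[t₀, ∞)` of the closed loop formed by the agents
`x_k' = A x_k + B u_k` and the controllers
`η_k' = (A + B K) η_k + ∑ j, a_kj(t) (η_j - η_k + x_k - x_j)`, `u_k = K η_k`:
the functions are continuous and satisfy the equations at every time `t > t₀` at which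
the Laplacian is continuous. Here `x k t` is the state of agent `k` at time `t`. -/
structure IsClosedLoopSolution {N n m : ℕ} (A : Matrix (Fin n) (Fin n) ℝ)
    (B : Matrix (Fin n) (Fin m) ℝ) (K : Matrix (Fin m) (Fin n) ℝ) (G : CommGraph N)
    (t₀ : ℝ) (x η : Fin N → ℝ → Fin n → ℝ) : Prop where
  continuousOn_x : ∀ k, ContinuousOn (x k) (Ici t₀)
  continuousOn_η : ∀ k, ContinuousOn (η k) (Ici t₀)
  deriv_x : ∀ t : ℝ, t₀ < t → ContinuousAt G.laplacian t → ∀ k,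
    HasDerivAt (x k) (A.mulVec (x k t) + B.mulVec (K.mulVec (η k t))) t
  deriv_η : ∀ t : ℝ, t₀ < t → ContinuousAt G.laplacian t → ∀ k,
    HasDerivAt (η k) ((A + B * K).mulVec (η k t) +
      ∑ j, G.weight t k j • (η j t - η k t + x k t - x j t)) t

/-- The Euclidean norm on `ℝⁿ`. -/
def euclNorm {n : ℕ} (v : Fin n → ℝ) : ℝ := ‖WithLp.toLp 2 v‖

end

/-! Put s_k = x_k - η_k. The feedback terms cancel, so s_k' = A s_k + ∑ a_kj (s_j - s_k). Scalar
weights commute with the flow of A, hence every coordinate of z_k(t) = exp((t₀ - t)A) s_k(t) solves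
the scalar consensus system z_k' = ∑ a_kj (z_j - z_k).

For scalar consensus (`exists_consensus_rate`), the interval spanned by the components never grows.
Over as many windows of length T as there are nodes, the influence of the root reaches every node,
so the end of the interval farther from the root's starting value moves in by a fixed fraction. The
resulting rate depends only on the number of nodes, the row-sum bound, T and δ.

Returning to s_k costs a factor exp((t - t₀)A). As A has no eigenvalue in the open right half-plane,
this grows at most like exp(ε(t - t₀)) for any ε > 0, and taking ε to be half the consensus rate
leaves decay towards x₀(t) = exp((t - t₀)A) z₀.

Finally η_k obeys the Hurwitz system A + BK forced by the exponentially vanishing coupling, so it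
decays (`norm_le_of_forced`), and x_k = s_k + η_k follows. Growth bounds on flows come from
Cayley–Hamilton, removing one linear factor at a time, rather than from a Jordan form. -/

/-! ### Growth of linear flows from the location of the eigenvalues -/

/-- If `∏ (f - μ)` over a multiset of scalars with real part `< r` annihilates a trajectory of
`y' = f y`, then the trajectory grows at most like `exp (r t)`. -/
theorem norm_le_exp_of_aeval_prod_eq_zero {n : ℕ} (f : Module.End ℂ (Fin n → ℂ)) (r : ℝ)
    (s : Multiset ℂ) (hs : ∀ μ ∈ s, μ.re < r) :
    ∃ C : ℝ, 0 ≤ C ∧ ∀ y : ℝ → Fin n → ℂ, (∀ t, HasDerivAt y (f (y t)) t) →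
      (∀ t, Polynomial.aeval f (s.map fun μ => Polynomial.X - Polynomial.C μ).prod (y t) = 0) →
      ∀ t, 0 ≤ t → ‖y t‖ ≤ C * Real.exp (r * t) * ‖y 0‖ := by
  induction s using Multiset.induction with
  | empty =>
    refine ⟨0, le_rfl, fun y _ h t _ => ?_⟩
    have := h t
    simp only [Multiset.map_zero, Multiset.prod_zero, map_one, Module.End.one_apply] at this
    simp [this]
  | cons μ s ih =>
    obtain ⟨C, hC, hb⟩ := ih fun ν hν => hs ν (Multiset.mem_cons_of_mem hν)
    have hμ : 0 < r - μ.re := sub_pos.2 (hs μ (Multiset.mem_cons_self _ _))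
    let F : (Fin n → ℂ) →L[ℂ] (Fin n → ℂ) := LinearMap.toContinuousLinearMap f
    let D : (Fin n → ℂ) →L[ℂ] (Fin n → ℂ) := F - μ • ContinuousLinearMap.id ℂ _
    have hD : ∀ v, D v = f v - μ • v := fun v => rfl
    refine ⟨1 + C * ‖D‖ / (r - μ.re), by positivity, fun y hy hann t ht => ?_⟩
    -- D = f - μ commutes with f, so D y is again a trajectory, annihilated by the remaining
    -- factors. The induction hypothesis bounds it, and (exp(-μt) y)' = exp(-μt) D y recovers y.
    have hw : ∀ t, HasDerivAt (fun t => D (y t)) (f (D (y t))) t := by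
      intro t
      have h := (D.restrictScalars ℝ).hasFDerivAt.comp_hasDerivAt t (hy t)
      have e : f (D (y t)) = D (f (y t)) := by simp only [hD, map_sub, map_smul]
      rw [e]; exact h
    have hwann : ∀ t, Polynomial.aeval f
        (s.map fun μ => Polynomial.X - Polynomial.C μ).prod (D (y t)) = 0 := by
      intro t
      have h := hann t
      rw [Multiset.map_cons, Multiset.prod_cons, mul_comm, map_mul, Module.End.mul_apply] at h
      simpa [hD, Algebra.algebraMap_eq_smul_one] using h
    have hwb := hb _ hw hwann
    have hE : ∀ t : ℝ, ‖Complex.exp (-(μ * t))‖ = Real.exp (-(μ.re * t)) := by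
      intro t; rw [Complex.norm_exp]; simp
    have hg : ∀ t : ℝ, HasDerivAt (fun t : ℝ => Complex.exp (-(μ * t)) • y t)
        (Complex.exp (-(μ * t)) • D (y t)) t := by
      intro t
      have h1 : HasDerivAt (fun t : ℝ => Complex.exp (-(μ * t))) (Complex.exp (-(μ * t)) * -μ) t := by
        have h0 : HasDerivAt (fun t : ℝ => -(μ * (t : ℂ))) (-(μ * 1)) t :=
          (HasDerivAt.ofReal_comp (hasDerivAt_id t)).const_mul μ |>.neg
        simpa using h0.cexp
      refine (h1.smul (hy t)).congr_deriv ?_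
      rw [hD, smul_sub, smul_smul, sub_eq_add_neg, mul_neg, neg_smul]
    -- The comparison function starts at ‖y 0‖ and integrates the bound on the derivative of
    -- exp(-μt) y. The strict gap r - Re μ > 0 keeps polynomial factors from appearing.
    have hB : ∀ t : ℝ, HasDerivAt
        (fun t => ‖y 0‖ * (1 + C * ‖D‖ / (r - μ.re) * (Real.exp ((r - μ.re) * t) - 1)))
        (C * ‖D‖ * ‖y 0‖ * Real.exp ((r - μ.re) * t)) t := by
      intro t
      have h0 : HasDerivAt (fun t => (r - μ.re) * t) (r - μ.re) t := by
        simpa using (hasDerivAt_id t).const_mul (r - μ.re)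
      refine ((((h0.exp).sub_const 1).const_mul (C * ‖D‖ / (r - μ.re))).const_add 1).const_mul
        ‖y 0‖ |>.congr_deriv ?_
      field_simp
    have hbound := image_norm_le_of_norm_deriv_right_le_deriv_boundary (a := 0) (b := t)
      (fun s _ => (hg s).continuousAt.continuousWithinAt) (fun s _ => (hg s).hasDerivWithinAt)
      (B := fun t => ‖y 0‖ * (1 + C * ‖D‖ / (r - μ.re) * (Real.exp ((r - μ.re) * t) - 1)))
      (by simp) hB (fun s hs => by
        rw [norm_smul, hE]
        calc Real.exp (-(μ.re * s)) * ‖D (y s)‖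
            ≤ Real.exp (-(μ.re * s)) * (C * Real.exp (r * s) * (‖D‖ * ‖y 0‖)) := by
              gcongr
              refine (hwb s hs.1).trans ?_
              gcongr
              exact D.le_opNorm _
          _ = C * ‖D‖ * ‖y 0‖ * (Real.exp (-(μ.re * s)) * Real.exp (r * s)) := by ring
          _ = C * ‖D‖ * ‖y 0‖ * Real.exp ((r - μ.re) * s) := by
              rw [← Real.exp_add]; ring_nf)
      (right_mem_Icc.2 ht)
    rw [norm_smul, hE] at hbound
    have h1 : 1 ≤ Real.exp ((r - μ.re) * t) := Real.one_le_exp (by positivity)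
    have hK : 0 ≤ C * ‖D‖ / (r - μ.re) := by positivity
    calc ‖y t‖ = Real.exp (μ.re * t) * (Real.exp (-(μ.re * t)) * ‖y t‖) := by
          rw [← mul_assoc, ← Real.exp_add]; simp
      _ ≤ Real.exp (μ.re * t) *
          (‖y 0‖ * (1 + C * ‖D‖ / (r - μ.re) * (Real.exp ((r - μ.re) * t) - 1))) := by gcongr
      _ ≤ Real.exp (μ.re * t) *
          (‖y 0‖ * ((1 + C * ‖D‖ / (r - μ.re)) * Real.exp ((r - μ.re) * t))) := by
          gcongr
          nlinarith
      _ = (1 + C * ‖D‖ / (r - μ.re)) * (Real.exp (μ.re * t) * Real.exp ((r - μ.re) * t)) * ‖y 0‖ := by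
          ring
      _ = _ := by rw [← Real.exp_add]; ring_nf

/-- A trajectory of a linear system whose eigenvalues have real part `< r` grows at most like
`exp (r t)`, with a constant that does not depend on the trajectory. -/
theorem exists_norm_le_exp_of_eigenvalues {n : ℕ} (f : Module.End ℂ (Fin n → ℂ)) (r : ℝ)
    (hf : ∀ μ, f.HasEigenvalue μ → μ.re < r) :
    ∃ C : ℝ, 0 ≤ C ∧ ∀ y : ℝ → Fin n → ℂ, (∀ t, HasDerivAt y (f (y t)) t) →
      ∀ t, 0 ≤ t → ‖y t‖ ≤ C * Real.exp (r * t) * ‖y 0‖ := by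
  -- By Cayley–Hamilton the product over the roots of the characteristic polynomial annihilates
  -- every vector.
  obtain ⟨C, hC, h⟩ := norm_le_exp_of_aeval_prod_eq_zero f r f.charpoly.roots fun μ hμ =>
    hf μ ((Module.End.hasEigenvalue_iff_isRoot_charpoly f μ).2
      (Polynomial.isRoot_of_mem_roots hμ))
  refine ⟨C, hC, fun y hy => h y hy fun t => ?_⟩
  rw [← (IsAlgClosed.splits f.charpoly).eq_prod_roots_of_monic f.charpoly_monic,
    LinearMap.aeval_self_charpoly]
  rfl

/-! ### The real matrix flow -/

/-- The continuous linear operator on `ℝⁿ` (with the sup norm) given by a matrix. -/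
noncomputable def matrixOp {n : ℕ} (A : Matrix (Fin n) (Fin n) ℝ) : (Fin n → ℝ) →L[ℝ] (Fin n → ℝ) :=
  LinearMap.toContinuousLinearMap (Matrix.toLin' A)

theorem matrixOp_apply {n : ℕ} (A : Matrix (Fin n) (Fin n) ℝ) (v : Fin n → ℝ) :
    matrixOp A v = A.mulVec v := rfl

/-- The flow `exp (t A)` of the linear system `y' = A y`. -/
noncomputable def matrixFlow {n : ℕ} (A : Matrix (Fin n) (Fin n) ℝ) (t : ℝ) :
    (Fin n → ℝ) →L[ℝ] (Fin n → ℝ) :=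
  NormedSpace.exp (t • matrixOp A)

theorem matrixFlow_zero {n : ℕ} (A : Matrix (Fin n) (Fin n) ℝ) : matrixFlow A 0 = 1 := by
  simp [matrixFlow]

theorem matrixFlow_add {n : ℕ} (A : Matrix (Fin n) (Fin n) ℝ) (s t : ℝ) :
    matrixFlow A (s + t) = matrixFlow A s * matrixFlow A t := by
  let _ : NormedAlgebra ℚ ((Fin n → ℝ) →L[ℝ] (Fin n → ℝ)) := NormedAlgebra.restrictScalars ℚ ℝ _
  rw [matrixFlow, add_smul]
  exact NormedSpace.exp_add_of_commute (((Commute.refl _).smul_left _).smul_right _)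

theorem matrixFlow_apply_neg {n : ℕ} (A : Matrix (Fin n) (Fin n) ℝ) (t : ℝ) (v : Fin n → ℝ) :
    matrixFlow A t (matrixFlow A (-t) v) = v := by
  rw [← mul_apply_eq_comp, ← matrixFlow_add]; simp [matrixFlow_zero]

theorem hasDerivAt_matrixFlow {n : ℕ} (A : Matrix (Fin n) (Fin n) ℝ) (t : ℝ) :
    HasDerivAt (matrixFlow A) (matrixOp A * matrixFlow A t) t :=
  hasDerivAt_exp_smul_const' (matrixOp A) t

theorem hasDerivAt_matrixFlow' {n : ℕ} (A : Matrix (Fin n) (Fin n) ℝ) (t : ℝ) :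
    HasDerivAt (matrixFlow A) (matrixFlow A t * matrixOp A) t :=
  hasDerivAt_exp_smul_const (matrixOp A) t

theorem continuous_matrixFlow {n : ℕ} (A : Matrix (Fin n) (Fin n) ℝ) : Continuous (matrixFlow A) :=
  continuous_iff_continuousAt.2 fun t => (hasDerivAt_matrixFlow A t).continuousAt

theorem hasDerivAt_matrixFlow_const {n : ℕ} (A : Matrix (Fin n) (Fin n) ℝ) (t : ℝ)
    (v : Fin n → ℝ) :
    HasDerivAt (fun t => matrixFlow A t v) (A.mulVec (matrixFlow A t v)) t := by
  simpa [matrixOp_apply] using (hasDerivAt_matrixFlow A t).clm_apply (hasDerivAt_const t v)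

/-- Variation of constants in differential form: conjugating a trajectory of
`y' = A y + f` by the flow leaves only the forcing term. -/
theorem hasDerivAt_matrixFlow_apply {n : ℕ} (A : Matrix (Fin n) (Fin n) ℝ) {c t : ℝ}
    {y : ℝ → Fin n → ℝ} {f : Fin n → ℝ} (hy : HasDerivAt y (A.mulVec (y t) + f) t) :
    HasDerivAt (fun τ => matrixFlow A (c - τ) (y τ)) (matrixFlow A (c - t) f) t := by
  have h1 : HasDerivAt (fun τ => matrixFlow A (c - τ)) (-(matrixFlow A (c - t) * matrixOp A)) t := by
    have h0 : HasDerivAt (fun τ : ℝ => c - τ) (-1) t := by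
      simpa using (hasDerivAt_id t).const_sub c
    exact ((hasDerivAt_matrixFlow' A (c - t)).scomp t h0).congr_deriv (by simp)
  refine (h1.clm_apply hy).congr_deriv ?_
  simp [matrixOp_apply]

/-- A real matrix whose complex eigenvalues have real part `< r` generates a flow of growth
at most `exp (r t)`. -/
theorem exists_norm_matrixFlow_le {n : ℕ} (A : Matrix (Fin n) (Fin n) ℝ) (r : ℝ)
    (hA : ∀ μ : ℂ, Module.End.HasEigenvalue (Matrix.toLin' (A.map Complex.ofReal)) μ → μ.re < r) :
    ∃ C : ℝ, 0 ≤ C ∧ ∀ t, 0 ≤ t → ‖matrixFlow A t‖ ≤ C * Real.exp (r * t) := by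
  obtain ⟨C, hC, h⟩ := exists_norm_le_exp_of_eigenvalues _ r hA
  refine ⟨C, hC, fun t ht => ContinuousLinearMap.opNorm_le_bound _ (by positivity) fun v => ?_⟩
  -- Complexification preserves the sup norm, so the complex growth bound descends with the same
  -- constant.
  let ι : (Fin n → ℝ) → (Fin n → ℂ) := fun v i => (v i : ℂ)
  have hι : ∀ v, ‖ι v‖ = ‖v‖ := by
    intro v
    simp only [Pi.norm_def, ι]
    congr 2
    ext i
    simp
  have hy : ∀ t, HasDerivAt (fun t => ι (matrixFlow A t v))
      (Matrix.toLin' (A.map Complex.ofReal) (ι (matrixFlow A t v))) t := by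
    intro t
    refine hasDerivAt_pi.2 fun i => ?_
    have h2 := (hasDerivAt_pi.1 (hasDerivAt_matrixFlow_const A t v) i).ofReal_comp
    refine h2.congr_deriv ?_
    simp [ι, Matrix.toLin'_apply, Matrix.mulVec, dotProduct]
  have := h _ hy t ht
  rwa [hι, hι, matrixFlow_zero] at this

/-- The spectrum is finite, so negative real parts stay uniformly away from 0. -/
theorem exists_forall_eigenvalue_re_lt {n : ℕ} (A : Matrix (Fin n) (Fin n) ℝ) (hA : IsHurwitz A) :
    ∃ r : ℝ, 0 < r ∧ ∀ μ : ℂ,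
      Module.End.HasEigenvalue (Matrix.toLin' (A.map Complex.ofReal)) μ → μ.re < -r := by
  have hfin := Module.End.finite_hasEigenvalue (Matrix.toLin' (A.map Complex.ofReal))
  obtain ⟨b, hb⟩ : ∃ b < (0 : ℝ), ∀ μ : ℂ,
      Module.End.HasEigenvalue (Matrix.toLin' (A.map Complex.ofReal)) μ → μ.re < b := by
    have h : ∀ᶠ b in 𝓝[<] (0 : ℝ), ∀ μ ∈ {μ : ℂ |
        Module.End.HasEigenvalue (Matrix.toLin' (A.map Complex.ofReal)) μ}, μ.re < b := by
      rw [Filter.eventually_all_finite hfin]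
      intro μ hμ
      exact (eventually_gt_nhds (hA μ hμ)).filter_mono nhdsWithin_le_nhds
    obtain ⟨b, h1, h2⟩ := (h.and self_mem_nhdsWithin).exists
    exact ⟨b, h2, h1⟩
  exact ⟨-b, by linarith [hb.1], by simpa using hb.2⟩

/-! ### Scalar consensus: positivity and propagation of lower bounds -/

/-- `z` solves the scalar consensus system `z_k' = ∑ j, a_kj (z_j - z_k)` on `[t₀, ∞)`, off a
countable set of times, for nonnegative locally integrable weights with row sums at most `α`. -/
structure IsConsensusSolution {ι : Type*} [Fintype ι] (a : ℝ → ι → ι → ℝ) (α t₀ : ℝ)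
    (z : ι → ℝ → ℝ) : Prop where
  nonneg : ∀ t, t₀ ≤ t → ∀ k j, 0 ≤ a t k j
  sum_le : ∀ t, t₀ ≤ t → ∀ k, ∑ j, a t k j ≤ α
  integrable : ∀ s t, t₀ ≤ s → s ≤ t → ∀ k j,
    IntervalIntegrable (fun τ => a τ k j) MeasureTheory.volume s t
  cont : ∀ k, ContinuousOn (z k) (Ici t₀)
  deriv : ∃ S : Set ℝ, S.Countable ∧ ∀ t, t₀ < t → t ∉ S → ∀ k,
    HasDerivAt (z k) (∑ j, a t k j * (z j t - z k t)) t

namespace IsConsensusSolution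

variable {ι : Type*} [Fintype ι] {a : ℝ → ι → ι → ℝ} {α t₀ : ℝ} {z : ι → ℝ → ℝ}

theorem mono (h : IsConsensusSolution a α t₀ z) {s : ℝ} (hs : t₀ ≤ s) :
    IsConsensusSolution a α s z where
  nonneg t ht := h.nonneg t (hs.trans ht)
  sum_le t ht := h.sum_le t (hs.trans ht)
  integrable u v hu := h.integrable u v (hs.trans hu)
  cont k := (h.cont k).mono (Ici_subset_Ici.2 hs)
  deriv := by
    obtain ⟨S, hS, hd⟩ := h.deriv
    exact ⟨S, hS, fun t ht => hd t (hs.trans_lt ht)⟩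

/-- The equation sees only differences of components. With `const_sub`, this reduces every upper or
lower bound to the nonnegative case. -/
theorem sub_const (h : IsConsensusSolution a α t₀ z) (c : ℝ) :
    IsConsensusSolution a α t₀ fun k t => z k t - c where
  nonneg := h.nonneg
  sum_le := h.sum_le
  integrable := h.integrable
  cont k := (h.cont k).sub continuousOn_const
  deriv := by
    obtain ⟨S, hS, hd⟩ := h.deriv
    refine ⟨S, hS, fun t ht htS k => ?_⟩
    simpa using (hd t ht htS k).sub_const c

theorem const_sub (h : IsConsensusSolution a α t₀ z) (c : ℝ) :
    IsConsensusSolution a α t₀ fun k t => c - z k t where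
  nonneg := h.nonneg
  sum_le := h.sum_le
  integrable := h.integrable
  cont k := continuousOn_const.sub (h.cont k)
  deriv := by
    obtain ⟨S, hS, hd⟩ := h.deriv
    refine ⟨S, hS, fun t ht htS k => ?_⟩
    refine ((hd t ht htS k).const_sub c).congr_deriv ?_
    rw [← Finset.sum_neg_distrib]
    exact Finset.sum_congr rfl fun j _ => by ring

/-- The integrand of the integrated form of the consensus equation: a nonnegative combination of
the `z_j`. -/
theorem intervalIntegrable_integrand (h : IsConsensusSolution a α t₀ z) {s t : ℝ} (hs : t₀ ≤ s)
    (hst : s ≤ t) (k : ι) :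
    IntervalIntegrable (fun τ => Real.exp (α * τ) *
      (∑ j, a τ k j * z j τ + (α - ∑ j, a τ k j) * z k τ)) MeasureTheory.volume s t := by
  have hsub : uIcc s t ⊆ Ici t₀ := by
    rw [uIcc_of_le hst]; exact fun x hx => hs.trans hx.1
  have hexp : ContinuousOn (fun τ => Real.exp (α * τ)) (uIcc s t) := by fun_prop
  refine IntervalIntegrable.continuousOn_mul (IntervalIntegrable.add ?_ ?_) hexp
  · have := IntervalIntegrable.sum (μ := MeasureTheory.volume) (a := s) (b := t) Finset.univ
      (f := fun j τ => a τ k j * z j τ) fun j _ =>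
        (h.integrable s t hs hst k j).mul_continuousOn ((h.cont j).mono hsub)
    simpa only [Finset.sum_fn] using this
  · refine IntervalIntegrable.mul_continuousOn ?_ ((h.cont k).mono hsub)
    refine IntervalIntegrable.sub intervalIntegrable_const ?_
    have := IntervalIntegrable.sum (μ := MeasureTheory.volume) (a := s) (b := t) Finset.univ
      (f := fun j τ => a τ k j) fun j _ => h.integrable s t hs hst k j
    simpa only [Finset.sum_fn] using this

/-- The integrating factor exp(ατ), with α bounding the row sums, turns the right-hand side into a
combination of the components with nonnegative coefficients. -/
theorem integral_eq (h : IsConsensusSolution a α t₀ z) {s t : ℝ} (hs : t₀ ≤ s) (hst : s ≤ t)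
    (k : ι) :
    ∫ τ in s..t, Real.exp (α * τ) * (∑ j, a τ k j * z j τ + (α - ∑ j, a τ k j) * z k τ) =
      Real.exp (α * t) * z k t - Real.exp (α * s) * z k s := by
  obtain ⟨S, hS, hd⟩ := h.deriv
  refine MeasureTheory.integral_eq_of_hasDerivAt_off_countable_of_le
    (fun τ => Real.exp (α * τ) * z k τ) _ hst hS ?_ ?_ (h.intervalIntegrable_integrand hs hst k)
  · refine ContinuousOn.mul (by fun_prop) ((h.cont k).mono fun x hx => hs.trans hx.1)
  · intro x hx
    have h0 : HasDerivAt (fun τ => Real.exp (α * τ)) (Real.exp (α * x) * α) x := by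
      have : HasDerivAt (fun τ => α * τ) α x := by simpa using (hasDerivAt_id x).const_mul α
      exact this.exp
    refine (h0.mul (hd x (hs.trans_lt hx.1.1) hx.2 k)).congr_deriv ?_
    simp only [mul_sub, Finset.sum_sub_distrib, sub_mul, Finset.sum_mul]
    ring

/-- Nonnegativity is preserved forward in time. -/
theorem nonneg_of_nonneg [Nonempty ι] (h : IsConsensusSolution a α t₀ z) (h0 : ∀ k, 0 ≤ z k t₀)
    {t : ℝ} (ht : t₀ ≤ t) (k : ι) : 0 ≤ z k t := by
  have hα : 0 ≤ α :=
    (Finset.sum_nonneg fun j _ => h.nonneg t₀ le_rfl k j).trans (h.sum_le t₀ le_rfl k)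
  -- the minimum over time of `exp (-τ) z_k τ`, for each `k`
  have hmin : ∀ k, ∃ τ ∈ Icc t₀ t, ∀ σ ∈ Icc t₀ t,
      Real.exp (-τ) * z k τ ≤ Real.exp (-σ) * z k σ := fun k =>
    isCompact_Icc.exists_isMinOn (nonempty_Icc.2 ht)
      (ContinuousOn.mul (by fun_prop) ((h.cont k).mono fun x hx => hx.1))
  choose τ hτ hτmin using hmin
  obtain ⟨i, -, hi⟩ := Finset.exists_min_image Finset.univ
    (fun k => Real.exp (-τ k) * z k (τ k)) Finset.univ_nonempty
  -- u is the minimum over all nodes and times, so u exp σ is a common lower barrier.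
  set u := Real.exp (-τ i) * z i (τ i) with hu
  have hlow : ∀ j, ∀ σ ∈ Icc t₀ t, u * Real.exp σ ≤ z j σ := by
    intro j σ hσ
    have h1 : u ≤ Real.exp (-σ) * z j σ := (hi j (Finset.mem_univ _)).trans (hτmin j σ hσ)
    calc u * Real.exp σ ≤ Real.exp (-σ) * z j σ * Real.exp σ := by gcongr
      _ = z j σ * (Real.exp (-σ) * Real.exp σ) := by ring
      _ = z j σ := by rw [← Real.exp_add]; simp
  suffices 0 ≤ u from (by positivity : 0 ≤ u * Real.exp t).trans (hlow k t ⟨ht, le_rfl⟩)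
  -- If u < 0, inserting the barrier into the integral identity up to τ i, where it is attained,
  -- gives u exp((α+1)τ i)/(α+1) ≥ 0. The weight exp(-τ) supplies the strictness: it replaces α by α
  -- + 1 in the denominator.
  by_contra! hneg
  have hint := h.integral_eq le_rfl (hτ i).1 i
  have hprim : ∫ σ in t₀..τ i, (u * α) * Real.exp ((α + 1) * σ) =
      u * α * ((Real.exp ((α + 1) * τ i) - Real.exp ((α + 1) * t₀)) / (α + 1)) := by
    rw [intervalIntegral.integral_const_mul]
    congr 1
    have := intervalIntegral.integral_comp_mul_left (a := t₀) (b := τ i) Real.exp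
      (c := α + 1) (by positivity)
    rw [this, integral_exp, smul_eq_mul]
    field_simp
  have hle : ∫ σ in t₀..τ i, (u * α) * Real.exp ((α + 1) * σ) ≤
      ∫ σ in t₀..τ i, Real.exp (α * σ) *
        (∑ j, a σ i j * z j σ + (α - ∑ j, a σ i j) * z i σ) := by
    refine intervalIntegral.integral_mono_on (hτ i).1 (Continuous.intervalIntegrable (by fun_prop) _ _)
      (h.intervalIntegrable_integrand le_rfl (hτ i).1 i) fun σ hσ => ?_
    have hσ' : σ ∈ Icc t₀ t := ⟨hσ.1, hσ.2.trans (hτ i).2⟩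
    have hs : ∑ j, a σ i j * (u * Real.exp σ) ≤ ∑ j, a σ i j * z j σ :=
      Finset.sum_le_sum fun j _ => mul_le_mul_of_nonneg_left (hlow j σ hσ') (h.nonneg σ hσ.1 i j)
    have hd := mul_le_mul_of_nonneg_left (hlow i σ hσ') (sub_nonneg.2 (h.sum_le σ hσ.1 i))
    rw [← Finset.sum_mul] at hs
    calc u * α * Real.exp ((α + 1) * σ)
        = Real.exp (α * σ) * (α * (u * Real.exp σ)) := by
          rw [add_mul, Real.exp_add, one_mul]; ring
      _ ≤ _ := by
          gcongr
          linarith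
  rw [hint, hprim] at hle
  have hz : Real.exp (α * τ i) * z i (τ i) = u * Real.exp ((α + 1) * τ i) := by
    rw [hu, add_mul, Real.exp_add, one_mul, Real.exp_neg]
    field_simp
  rw [hz] at hle
  have h2 : 0 ≤ Real.exp (α * t₀) * z i t₀ := mul_nonneg (Real.exp_pos _).le (h0 i)
  have h3 := Real.exp_pos ((α + 1) * t₀)
  have h4 := Real.exp_pos ((α + 1) * τ i)
  have h5 : u * α * ((Real.exp ((α + 1) * τ i) - Real.exp ((α + 1) * t₀)) / (α + 1)) =
      u * Real.exp ((α + 1) * τ i) - u * Real.exp ((α + 1) * τ i) / (α + 1)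
        - u * α * Real.exp ((α + 1) * t₀) / (α + 1) := by
    field_simp; ring
  rw [h5] at hle
  have h6 : u * Real.exp ((α + 1) * τ i) / (α + 1) < 0 :=
    div_neg_of_neg_of_pos (mul_neg_of_neg_of_pos hneg h4) (by positivity)
  have h7 : u * α * Real.exp ((α + 1) * t₀) / (α + 1) ≤ 0 :=
    div_nonpos_of_nonpos_of_nonneg
      (mul_nonpos_of_nonpos_of_nonneg (mul_nonpos_of_nonpos_of_nonneg hneg.le hα) h3.le)
      (by positivity)
  linarith

/-- A nonnegative component decays at rate at most `α`. -/
theorem exp_mul_le [Nonempty ι] (h : IsConsensusSolution a α t₀ z) (h0 : ∀ k, 0 ≤ z k t₀)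
    {t : ℝ} (ht : t₀ ≤ t) (k : ι) : Real.exp (-α * (t - t₀)) * z k t₀ ≤ z k t := by
  have hint := h.integral_eq le_rfl ht k
  have hpos : 0 ≤ ∫ τ in t₀..t, Real.exp (α * τ) *
      (∑ j, a τ k j * z j τ + (α - ∑ j, a τ k j) * z k τ) := by
    refine intervalIntegral.integral_nonneg ht fun τ hτ => ?_
    have h1 := fun j => h.nonneg_of_nonneg h0 hτ.1 j
    have h2 := h.nonneg τ hτ.1 k
    have h3 := sub_nonneg.2 (h.sum_le τ hτ.1 k)
    exact mul_nonneg (Real.exp_pos _).le (add_nonneg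
      (Finset.sum_nonneg fun j _ => mul_nonneg (h2 j) (h1 j)) (mul_nonneg h3 (h1 k)))
  rw [hint] at hpos
  calc Real.exp (-α * (t - t₀)) * z k t₀
      = Real.exp (-α * t) * (Real.exp (α * t₀) * z k t₀) := by
        rw [← mul_assoc, ← Real.exp_add]; ring_nf
    _ ≤ Real.exp (-α * t) * (Real.exp (α * t) * z k t) :=
        mul_le_mul_of_nonneg_left (by linarith) (Real.exp_pos _).le
    _ = z k t := by rw [← mul_assoc, ← Real.exp_add]; ring_nf; simp

/-- A nonnegative component is pulled up by a neighbor of it that starts above `c`. -/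
theorem le_of_integral_ge [Nonempty ι] (h : IsConsensusSolution a α t₀ z)
    (h0 : ∀ k, 0 ≤ z k t₀) {T δ c : ℝ} (hT : 0 ≤ T) (hc : 0 ≤ c) {p q : ι}
    (hq : c ≤ z q t₀) (hpq : δ ≤ ∫ τ in t₀..t₀ + T, a τ p q) :
    δ * Real.exp (-(2 * α) * T) * c ≤ z p (t₀ + T) := by
  have hα : 0 ≤ α :=
    (Finset.sum_nonneg fun j _ => h.nonneg t₀ le_rfl p j).trans (h.sum_le t₀ le_rfl p)
  have hle : t₀ ≤ t₀ + T := by linarith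
  have hint := h.integral_eq le_rfl hle p
  -- Of the two factors exp(-αT) in the gain, one is the possible decay of z q within the window.
  -- The other comes from dividing by the integrating factor at the window's end.
  have hmono : ∫ τ in t₀..t₀ + T, (Real.exp (α * t₀) * (Real.exp (-α * T) * c)) * a τ p q ≤
      ∫ τ in t₀..t₀ + T, Real.exp (α * τ) *
        (∑ j, a τ p j * z j τ + (α - ∑ j, a τ p j) * z p τ) := by
    refine intervalIntegral.integral_mono_on hle ((h.integrable _ _ le_rfl hle p q).const_mul _)
      (h.intervalIntegrable_integrand le_rfl hle p) fun τ hτ => ?_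
    have h1 := fun j => h.nonneg_of_nonneg h0 hτ.1 j
    have h2 := h.nonneg τ hτ.1 p
    have h3 := sub_nonneg.2 (h.sum_le τ hτ.1 p)
    have h4 : Real.exp (-α * T) * c ≤ z q τ := by
      refine le_trans ?_ (h.exp_mul_le h0 hτ.1 q)
      gcongr ?_ * ?_
      apply Real.exp_le_exp.2
      nlinarith [hτ.2]
    have h5 : a τ p q * z q τ ≤ ∑ j, a τ p j * z j τ :=
      Finset.single_le_sum (f := fun j => a τ p j * z j τ)
        (fun j _ => mul_nonneg (h2 j) (h1 j)) (Finset.mem_univ q)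
    have h6 := mul_nonneg h3 (h1 p)
    have h7 : Real.exp (α * t₀) ≤ Real.exp (α * τ) := by
      apply Real.exp_le_exp.2; exact mul_le_mul_of_nonneg_left hτ.1 hα
    calc Real.exp (α * t₀) * (Real.exp (-α * T) * c) * a τ p q
        = Real.exp (α * t₀) * (a τ p q * (Real.exp (-α * T) * c)) := by ring
      _ ≤ Real.exp (α * τ) * (a τ p q * z q τ) := by
          have := h2 q
          gcongr
      _ ≤ _ := by gcongr; linarith
  rw [intervalIntegral.integral_const_mul, hint] at hmono
  have hzp : 0 ≤ Real.exp (α * t₀) * z p t₀ := mul_nonneg (Real.exp_pos _).le (h0 p)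
  have hfin : Real.exp (α * t₀) * (Real.exp (-α * T) * c) * δ ≤
      Real.exp (α * (t₀ + T)) * z p (t₀ + T) := by
    refine le_trans ?_ (by linarith : Real.exp (α * t₀) * (Real.exp (-α * T) * c) *
      ∫ τ in t₀..t₀ + T, a τ p q ≤ _)
    gcongr
  calc δ * Real.exp (-(2 * α) * T) * c
      = Real.exp (-α * (t₀ + T)) * (Real.exp (α * t₀) * (Real.exp (-α * T) * c) * δ) := by
        have : Real.exp (-(2 * α) * T) =
            Real.exp (-α * (t₀ + T)) * Real.exp (α * t₀) * Real.exp (-α * T) := by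
          rw [← Real.exp_add, ← Real.exp_add]; ring_nf
        rw [this]; ring
    _ ≤ Real.exp (-α * (t₀ + T)) * (Real.exp (α * (t₀ + T)) * z p (t₀ + T)) := by gcongr
    _ = z p (t₀ + T) := by rw [← mul_assoc, ← Real.exp_add]; ring_nf; simp

end IsConsensusSolution

/-! ### Connectivity and contraction of the spanned interval -/

theorem Relation.TransGen.exists_crossing {ι : Type*} {R : ι → ι → Prop} {j r : ι}
    (h : Relation.TransGen R j r) (S : Finset ι) (hj : j ∉ S) (hr : r ∈ S) :
    ∃ p q, p ∉ S ∧ q ∈ S ∧ R p q := by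
  induction h using Relation.TransGen.head_induction_on with
  | single h => exact ⟨_, _, hj, hr, h⟩
  | @head p q hpq _ ih =>
    by_cases hq : q ∈ S
    · exact ⟨_, _, hj, hq, hpq⟩
    · exact ih hq

/-- The node `r` is reached from every other node through the integrated graphs of all windows of
length `T` after time `t₀`. -/
def ReachesUniformly {ι : Type*} (a : ℝ → ι → ι → ℝ) (T δ t₀ : ℝ) (r : ι) : Prop :=
  ∀ t, t₀ ≤ t → ∀ j, j ≠ r →
    Relation.TransGen (fun p q => δ ≤ ∫ τ in t..t + T, a τ p q) j r

theorem ReachesUniformly.mono {ι : Type*} {a : ℝ → ι → ι → ℝ} {T δ t₀ s : ℝ} {r : ι}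
    (h : ReachesUniformly a T δ t₀ r) (hs : t₀ ≤ s) : ReachesUniformly a T δ s r :=
  fun t ht => h t (hs.trans ht)

/-- The fraction of a lower bound that survives one window of length `T`. -/
noncomputable def windowGain (α T δ : ℝ) : ℝ :=
  min (Real.exp (-α * T)) (δ * Real.exp (-(2 * α) * T))

theorem windowGain_pos {α T δ : ℝ} (hδ : 0 < δ) : 0 < windowGain α T δ :=
  lt_min (Real.exp_pos _) (mul_pos hδ (Real.exp_pos _))

theorem windowGain_le_one {α T δ : ℝ} (hα : 0 ≤ α) (hT : 0 ≤ T) : windowGain α T δ ≤ 1 :=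
  (min_le_left _ _).trans (Real.exp_le_one_iff.2 (by nlinarith))

namespace IsConsensusSolution

variable {ι : Type*} [Fintype ι] [Nonempty ι] {a : ℝ → ι → ι → ℝ} {α t₀ : ℝ} {z : ι → ℝ → ℝ}

/-- After `i` windows, at least `i + 1` nodes have been pulled up by the root. -/
theorem exists_finset_lower_bound (h : IsConsensusSolution a α t₀ z) (h0 : ∀ k, 0 ≤ z k t₀)
    {T δ c : ℝ} (hT : 0 < T) (hδ : 0 < δ) (hc : 0 ≤ c) {r : ι}
    (hr : ReachesUniformly a T δ t₀ r) (hzr : c ≤ z r t₀) (i : ℕ) :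
    ∃ S : Finset ι, r ∈ S ∧ min (i + 1) (Fintype.card ι) ≤ S.card ∧
      ∀ j ∈ S, windowGain α T δ ^ i * c ≤ z j (t₀ + i * T) := by
  classical
  induction i with
  | zero => exact ⟨{r}, by simp, by simp, by simpa using hzr⟩
  | succ i ih =>
    obtain ⟨S, hrS, hcard, hS⟩ := ih
    have hβ := windowGain_pos (α := α) (T := T) hδ
    have hti : t₀ ≤ t₀ + i * T := by nlinarith [Nat.cast_nonneg (α := ℝ) i]
    have h' := h.mono hti
    have h0' : ∀ k, 0 ≤ z k (t₀ + i * T) := fun k => h.nonneg_of_nonneg h0 hti k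
    have hci : 0 ≤ windowGain α T δ ^ i * c := by positivity
    have htime : t₀ + ((i + 1 : ℕ) : ℝ) * T = t₀ + i * T + T := by push_cast; ring
    -- Nodes already reached lose at most exp(-αT) per window, while a new node gains δ exp(-2αT)
    -- times its neighbor's bound. `windowGain` is the smaller factor and serves both.
    have hstay : ∀ j ∈ S, windowGain α T δ ^ (i + 1) * c ≤ z j (t₀ + ((i + 1 : ℕ) : ℝ) * T) := by
      intro j hj
      rw [htime]
      refine le_trans ?_ (h'.exp_mul_le h0' (by linarith) j)
      rw [pow_succ', mul_assoc, add_sub_cancel_left]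
      exact mul_le_mul (min_le_left _ _) (hS j hj) hci (Real.exp_pos _).le
    by_cases huniv : S = Finset.univ
    · exact ⟨S, hrS, by simp [huniv], hstay⟩
    · obtain ⟨j, hj⟩ : ∃ j, j ∉ S := by
        by_contra! hall
        exact huniv (Finset.eq_univ_iff_forall.2 hall)
      -- A path from an unreached node to the root must enter S; the entering edge makes p receive
      -- information from q ∈ S.
      obtain ⟨p, q, hp, hq, hpq⟩ :=
        (hr _ hti j (fun hjr => hj (hjr ▸ hrS))).exists_crossing S hj hrS
      refine ⟨insert p S, Finset.mem_insert_of_mem hrS, ?_, fun k hk => ?_⟩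
      · rw [Finset.card_insert_of_notMem hp]
        omega
      · rcases Finset.mem_insert.1 hk with rfl | hk
        · rw [htime]
          refine le_trans ?_ (h'.le_of_integral_ge h0' hT.le hci (hS q hq) hpq)
          rw [pow_succ', mul_assoc]
          exact mul_le_mul_of_nonneg_right (min_le_right _ _) hci
        · exact hstay k hk

theorem lower_bound_of_root (h : IsConsensusSolution a α t₀ z) (h0 : ∀ k, 0 ≤ z k t₀)
    {T δ c : ℝ} (hT : 0 < T) (hδ : 0 < δ) (hc : 0 ≤ c) {r : ι}
    (hr : ReachesUniformly a T δ t₀ r) (hzr : c ≤ z r t₀) (k : ι) :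
    windowGain α T δ ^ Fintype.card ι * c ≤ z k (t₀ + Fintype.card ι * T) := by
  obtain ⟨S, -, hcard, hS⟩ := h.exists_finset_lower_bound h0 hT hδ hc hr hzr (Fintype.card ι)
  have hu : S = Finset.univ := by
    rw [← Finset.card_eq_iff_eq_univ]
    have := S.card_le_univ
    omega
  exact hS k (hu ▸ Finset.mem_univ k)

theorem le_of_le (h : IsConsensusSolution a α t₀ z) {m : ℝ} (h0 : ∀ k, m ≤ z k t₀)
    {t : ℝ} (ht : t₀ ≤ t) (k : ι) : m ≤ z k t := by
  simpa using (h.sub_const m).nonneg_of_nonneg (by simpa using h0) ht k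

theorem ge_of_ge (h : IsConsensusSolution a α t₀ z) {m : ℝ} (h0 : ∀ k, z k t₀ ≤ m)
    {t : ℝ} (ht : t₀ ≤ t) (k : ι) : z k t ≤ m := by
  simpa using (h.const_sub m).nonneg_of_nonneg (by simpa using h0) ht k

/-- An interval containing all components shrinks by a fixed factor over `card ι` windows. -/
theorem exists_shrunk_interval (h : IsConsensusSolution a α t₀ z) {m M : ℝ}
    (hm : ∀ k, m ≤ z k t₀) (hM : ∀ k, z k t₀ ≤ M) {T δ : ℝ} (hT : 0 < T) (hδ : 0 < δ) {r : ι}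
    (hr : ReachesUniformly a T δ t₀ r) :
    ∃ m' M', M' - m' = (1 - windowGain α T δ ^ Fintype.card ι / 2) * (M - m) ∧
      (∀ k, m' ≤ z k (t₀ + Fintype.card ι * T)) ∧ ∀ k, z k (t₀ + Fintype.card ι * T) ≤ M' := by
  have ht : t₀ ≤ t₀ + Fintype.card ι * T := by
    nlinarith [Nat.cast_nonneg (α := ℝ) (Fintype.card ι)]
  have hmM : 0 ≤ (M - m) / 2 := by linarith [hm r, hM r]
  -- If the root starts in the upper half, z - m has root value at least (M - m)/2 and the lower end
  -- rises. Otherwise the same argument for M - z brings the upper end down.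
  rcases le_total ((M + m) / 2) (z r t₀) with hmid | hmid
  · refine ⟨m + windowGain α T δ ^ Fintype.card ι * ((M - m) / 2), M, by ring, fun k => ?_,
      fun k => h.ge_of_ge hM ht k⟩
    have := (h.sub_const m).lower_bound_of_root (by simpa using hm) hT hδ hmM hr (by linarith) k
    linarith
  · refine ⟨m, M - windowGain α T δ ^ Fintype.card ι * ((M - m) / 2), by ring,
      fun k => h.le_of_le hm ht k, fun k => ?_⟩
    have := (h.const_sub M).lower_bound_of_root (by simpa using hM) hT hδ hmM hr (by linarith) k
    linarith

end IsConsensusSolution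

/-- Since ⌊x⌋₊ > x - 1 and q ≤ 1, rounding down costs at most a factor q⁻¹. This turns decay per
block of windows into a continuous exponential rate. -/
theorem pow_floor_le_exp {q x : ℝ} (hq : 0 < q) (hq1 : q ≤ 1) :
    q ^ ⌊x⌋₊ ≤ q⁻¹ * Real.exp (Real.log q * x) := by
  rw [← Real.rpow_natCast, ← Real.rpow_def_of_pos hq, ← Real.rpow_neg_one, ← Real.rpow_add hq]
  exact Real.rpow_le_rpow_of_exponent_ge hq hq1 (by linarith [Nat.lt_floor_add_one x])

/-- Exponential consensus, uniformly in the weights, the initial time and the initial state. -/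
theorem exists_consensus_rate (ι : Type*) [Fintype ι] [Nonempty ι] {α T δ : ℝ} (hα : 0 ≤ α)
    (hT : 0 < T) (hδ : 0 < δ) :
    ∃ M > 0, ∃ lam > 0, ∀ (a : ℝ → ι → ι → ℝ) (t₀ : ℝ) (z : ι → ℝ → ℝ) (r : ι),
      IsConsensusSolution a α t₀ z → ReachesUniformly a T δ t₀ r →
      ∃ z₀ : ℝ, ∀ t, t₀ ≤ t → ∀ k,
        |z k t - z₀| ≤ M * Real.exp (-lam * (t - t₀)) * ∑ j, |z j t₀ - z₀| := by
  set κ := windowGain α T δ ^ Fintype.card ι / 2 with hκ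
  have hκ0 : 0 < κ := half_pos (pow_pos (windowGain_pos hδ) _)
  have hκ1 : κ ≤ 1 / 2 := div_le_div_of_nonneg_right
    (pow_le_one₀ (windowGain_pos hδ).le (windowGain_le_one hα hT.le)) zero_le_two
  set P := (Fintype.card ι : ℝ) * T with hP
  have hP0 : 0 < P := mul_pos (Nat.cast_pos.2 Fintype.card_pos) hT
  have hq0 : 0 < 1 - κ := by linarith
  -- The factor 2 bounds the initial spread by the distances to z₀, and (1 - κ)⁻¹ pays for an
  -- incomplete block of length P.
  refine ⟨2 * (1 - κ)⁻¹, by positivity, -Real.log (1 - κ) / P,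
    div_pos (neg_pos.2 (Real.log_neg hq0 (by linarith))) hP0, fun a t₀ z r h hr => ?_⟩
  let lo : ℝ → ℝ := fun t => Finset.univ.inf' Finset.univ_nonempty fun k => z k t
  let up : ℝ → ℝ := fun t => Finset.univ.sup' Finset.univ_nonempty fun k => z k t
  have hlo : ∀ t k, lo t ≤ z k t := fun t k => Finset.inf'_le _ (Finset.mem_univ k)
  have hup : ∀ t k, z k t ≤ up t := fun t k =>
    Finset.le_sup' (fun k => z k t) (Finset.mem_univ k)
  have hlomono : ∀ s t, t₀ ≤ s → s ≤ t → lo s ≤ lo t := fun s t hs hst =>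
    Finset.le_inf' _ _ fun k _ => (h.mono hs).le_of_le (hlo s) hst k
  have hupanti : ∀ s t, t₀ ≤ s → s ≤ t → up t ≤ up s := fun s t hs hst =>
    Finset.sup'_le _ _ fun k _ => (h.mono hs).ge_of_ge (hup s) hst k
  have hloup : ∀ s t, t₀ ≤ s → t₀ ≤ t → lo s ≤ up t := fun s t hs ht =>
    (hlomono s _ hs (le_max_left s t)).trans <| (hlo _ r).trans <| (hup _ r).trans <|
      hupanti t _ ht (le_max_right s t)
  -- The lower envelope increases and stays below the decreasing upper one, so z₀ lies in the
  -- spanned interval at every time.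
  set z₀ := sSup (lo '' Ici t₀) with hz₀
  have hz₀lo : ∀ t, t₀ ≤ t → lo t ≤ z₀ := fun t ht =>
    le_csSup ⟨up t₀, by rintro _ ⟨s, hs, rfl⟩; exact hloup s t₀ hs le_rfl⟩ ⟨t, ht, rfl⟩
  have hz₀up : ∀ t, t₀ ≤ t → z₀ ≤ up t := fun t ht =>
    csSup_le ⟨_, t₀, self_mem_Ici, rfl⟩ (by rintro _ ⟨s, hs, rfl⟩; exact hloup s t hs ht)
  have hstep : ∀ t, t₀ ≤ t → up (t + P) - lo (t + P) ≤ (1 - κ) * (up t - lo t) := by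
    intro t ht
    obtain ⟨m', M', he, hm', hM'⟩ :=
      (h.mono ht).exists_shrunk_interval (hlo t) (hup t) hT hδ (hr.mono ht)
    rw [← he]
    exact sub_le_sub (Finset.sup'_le _ _ fun k _ => hM' k) (Finset.le_inf' _ _ fun k _ => hm' k)
  have hiter : ∀ i : ℕ, up (t₀ + i * P) - lo (t₀ + i * P) ≤ (1 - κ) ^ i * (up t₀ - lo t₀) := by
    intro i
    induction i with
    | zero => simp
    | succ i ih =>
      have e : t₀ + ((i + 1 : ℕ) : ℝ) * P = t₀ + i * P + P := by push_cast; ring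
      rw [e, pow_succ', mul_assoc]
      exact (hstep _ (by nlinarith [Nat.cast_nonneg (α := ℝ) i])).trans
        (mul_le_mul_of_nonneg_left ih hq0.le)
  have hinit : up t₀ - lo t₀ ≤ 2 * ∑ j, |z j t₀ - z₀| := by
    obtain ⟨i, -, hi⟩ := Finset.exists_mem_eq_sup' Finset.univ_nonempty fun k => z k t₀
    obtain ⟨j, -, hj⟩ := Finset.exists_mem_eq_inf' Finset.univ_nonempty fun k => z k t₀
    have hs : ∀ k, |z k t₀ - z₀| ≤ ∑ j, |z j t₀ - z₀| := fun k =>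
      Finset.single_le_sum (f := fun j => |z j t₀ - z₀|) (fun j _ => abs_nonneg _)
        (Finset.mem_univ k)
    have h1 : up t₀ = z i t₀ := hi
    have h2 : lo t₀ = z j t₀ := hj
    rw [h1, h2]
    linarith [hs i, hs j, le_abs_self (z i t₀ - z₀), neg_abs_le (z j t₀ - z₀)]
  refine ⟨z₀, fun t ht k => ?_⟩
  have hx : 0 ≤ (t - t₀) / P := div_nonneg (sub_nonneg.2 ht) hP0.le
  set i := ⌊(t - t₀) / P⌋₊ with hi
  have hit : t₀ + i * P ≤ t := by
    have := Nat.floor_le hx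
    rw [le_div_iff₀ hP0] at this
    linarith
  have hti : t₀ ≤ t₀ + i * P := by nlinarith [Nat.cast_nonneg (α := ℝ) i]
  have hd0 : 0 ≤ up t₀ - lo t₀ := sub_nonneg.2 (hloup _ _ le_rfl le_rfl)
  calc |z k t - z₀| ≤ up t - lo t := by
        rw [abs_le]
        constructor <;> linarith [hlo t k, hup t k, hz₀lo t ht, hz₀up t ht]
    _ ≤ up (t₀ + i * P) - lo (t₀ + i * P) := sub_le_sub (hupanti _ _ hti hit) (hlomono _ _ hti hit)
    _ ≤ (1 - κ) ^ i * (up t₀ - lo t₀) := hiter i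
    _ ≤ (1 - κ)⁻¹ * Real.exp (Real.log (1 - κ) * ((t - t₀) / P)) * (2 * ∑ j, |z j t₀ - z₀|) :=
        mul_le_mul (pow_floor_le_exp hq0 (by linarith)) hinit hd0 (by positivity)
    _ = _ := by
        have : Real.log (1 - κ) * ((t - t₀) / P) = - (-Real.log (1 - κ) / P) * (t - t₀) := by ring
        rw [this]; ring

/-! ### Integrability of the weights -/

/-- The times at which a function on `[0, ∞)` is discontinuous. -/
def discontinuityTimes {E : Type*} [TopologicalSpace E] (f : ℝ → E) : Set ℝ :=
  {t | 0 ≤ t ∧ ¬ ContinuousWithinAt f (Ici 0) t}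

theorem PiecewiseContinuous.countable_discontinuityTimes {E : Type*} [TopologicalSpace E]
    {f : ℝ → E} (hf : PiecewiseContinuous f) : (discontinuityTimes f).Countable := by
  refine (countable_iUnion fun n : ℕ => (hf.1 n).countable).mono fun t ht => ?_
  obtain ⟨n, hn⟩ := exists_nat_ge t
  exact mem_iUnion.2 ⟨n, ⟨ht.1, hn⟩, ht.2⟩

theorem continuousAt_of_notMem_discontinuityTimes {E : Type*} [TopologicalSpace E]
    {f : ℝ → E} {t : ℝ} (ht : 0 < t) (h : t ∉ discontinuityTimes f) : ContinuousAt f t := by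
  have : ContinuousWithinAt f (Ici 0) t := by
    by_contra hc
    exact h ⟨ht.le, hc⟩
  exact this.continuousAt (Ici_mem_nhds ht)

/-- A real function that is bounded on `[0, ∞)` and continuous there off a countable set is
integrable on bounded intervals. -/
theorem intervalIntegrable_of_bounded_of_countable {g : ℝ → ℝ} {S : Set ℝ} (hS : S.Countable)
    (hg : ∀ t, 0 ≤ t → t ∉ S → ContinuousWithinAt g (Ici 0) t) {C : ℝ}
    (hC : ∀ t, 0 ≤ t → |g t| ≤ C) {s t : ℝ} (hs : 0 ≤ s) (hst : s ≤ t) :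
    IntervalIntegrable g MeasureTheory.volume s t := by
  rw [intervalIntegrable_iff_integrableOn_Ioc_of_le hst]
  have hsub : Ioc s t \ S ⊆ Ici 0 := fun x hx => hs.trans hx.1.1.le
  have hcont : ContinuousOn g (Ioc s t \ S) := fun x hx =>
    (hg x (hsub hx) hx.2).mono hsub
  have hae : (Ioc s t \ S : Set ℝ) =ᵐ[MeasureTheory.volume] Ioc s t :=
    MeasureTheory.sdiff_null_ae_eq_self (hS.measure_zero _)
  refine (MeasureTheory.integrableOn_congr_set_ae hae).1 ?_
  refine MeasureTheory.IntegrableOn.of_bound ?_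
    (hcont.aestronglyMeasurable (measurableSet_Ioc.diff hS.measurableSet)) C ?_
  · exact (MeasureTheory.measure_mono sdiff_subset).trans_lt measure_Ioc_lt_top
  · exact (MeasureTheory.ae_restrict_mem (measurableSet_Ioc.diff hS.measurableSet)).mono
      fun x hx => hC x (hsub hx)

namespace CommGraph

variable {N : ℕ} (G : CommGraph N)

theorem weight_nonneg {t : ℝ} (ht : 0 ≤ t) (k j : Fin N) : 0 ≤ G.weight t k j := by
  rcases G.weight_mem t ht k j with h | h
  · exact h.ge
  · exact G.lo_pos.le.trans h.1

theorem hi_pos : 0 < G.hi := G.lo_pos.trans_le G.lo_le_hi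

theorem weight_le {t : ℝ} (ht : 0 ≤ t) (k j : Fin N) : G.weight t k j ≤ G.hi := by
  rcases G.weight_mem t ht k j with h | h
  · exact h.le.trans G.hi_pos.le
  · exact h.2

theorem sum_weight_le {t : ℝ} (ht : 0 ≤ t) (k : Fin N) : ∑ j, G.weight t k j ≤ N * G.hi := by
  simpa using Finset.sum_le_card_nsmul Finset.univ (fun j => G.weight t k j) G.hi
    fun j _ => G.weight_le ht k j

theorem intervalIntegrable_weight (hpc : PiecewiseContinuous G.laplacian) {s t : ℝ} (hs : 0 ≤ s)
    (hst : s ≤ t) (k j : Fin N) :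
    IntervalIntegrable (fun τ => G.weight τ k j) MeasureTheory.volume s t := by
  refine intervalIntegrable_of_bounded_of_countable (C := G.hi) hpc.countable_discontinuityTimes
    (fun t ht htS => ?_) (fun t ht => ?_) hs hst
  · have hL : ContinuousWithinAt G.laplacian (Ici 0) t := by
      by_contra hc
      exact htS ⟨ht, hc⟩
    -- A diagonal Laplacian entry is a row sum and does not give the weight; the absence of
    -- self-loops does.
    by_cases hjk : j = k
    · subst hjk
      exact (continuousWithinAt_const (b := (0 : ℝ))).congr (fun τ hτ => G.no_loops τ hτ j)
        (G.no_loops t ht j)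
    · have h2 : (fun τ => G.weight τ k j) = fun τ => - G.laplacian τ k j := by
        ext τ; simp [laplacian, hjk]
      rw [h2]
      exact (continuousWithinAt_pi.1 (continuousWithinAt_pi.1 hL k) j).neg
  · rw [abs_of_nonneg (G.weight_nonneg ht k j)]
    exact G.weight_le ht k j

end CommGraph

/-! ### Norm comparison and forced linear systems -/

theorem norm_le_euclNorm {n : ℕ} (v : Fin n → ℝ) : ‖v‖ ≤ euclNorm v :=
  (pi_norm_le_iff_of_nonneg (norm_nonneg _)).2 fun i => PiLp.norm_apply_le (WithLp.toLp 2 v) i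

theorem exists_euclNorm_le (n : ℕ) : ∃ c > 0, ∀ v : Fin n → ℝ, euclNorm v ≤ c * ‖v‖ := by
  let e : (Fin n → ℝ) →L[ℝ] EuclideanSpace ℝ (Fin n) :=
    (PiLp.continuousLinearEquiv 2 ℝ fun _ : Fin n => ℝ).symm.toContinuousLinearMap
  refine ⟨‖e‖ + 1, by positivity, fun v => (e.le_opNorm v).trans ?_⟩
  gcongr
  linarith

/-- A linear system with a decaying flow, forced by a term decaying at a slower rate `ν`, decays
at the rate `ν`. -/
theorem norm_le_of_forced {n : ℕ} (H : Matrix (Fin n) (Fin n) ℝ) {C μ ν F t₀ : ℝ} (hC : 0 ≤ C)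
    (hF : 0 ≤ F) (hνμ : ν < μ) (hflow : ∀ t, 0 ≤ t → ‖matrixFlow H t‖ ≤ C * Real.exp (-μ * t))
    {y f : ℝ → Fin n → ℝ} {S : Set ℝ} (hS : S.Countable) (hy : ContinuousOn y (Ici t₀))
    (hd : ∀ t, t₀ < t → t ∉ S → HasDerivAt y (H.mulVec (y t) + f t) t)
    (hfi : ∀ t, t₀ ≤ t → IntervalIntegrable f MeasureTheory.volume t₀ t)
    (hf : ∀ t, t₀ ≤ t → ‖f t‖ ≤ F * Real.exp (-ν * (t - t₀))) {t : ℝ} (ht : t₀ ≤ t) :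
    ‖y t‖ ≤ C * (‖y t₀‖ + F / (μ - ν)) * Real.exp (-ν * (t - t₀)) := by
  have hμν : 0 < μ - ν := sub_pos.2 hνμ
  have hcf : Continuous fun τ => matrixFlow H (t - τ) :=
    (continuous_matrixFlow H).comp (continuous_const.sub continuous_id)
  have hbound : ∀ τ ∈ Ioc t₀ t, ‖matrixFlow H (t - τ) (f τ)‖ ≤
      C * F * (Real.exp (-μ * t + ν * t₀) * Real.exp ((μ - ν) * τ)) := by
    intro τ hτ
    calc ‖matrixFlow H (t - τ) (f τ)‖ ≤ ‖matrixFlow H (t - τ)‖ * ‖f τ‖ :=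
          ContinuousLinearMap.le_opNorm _ _
      _ ≤ (C * Real.exp (-μ * (t - τ))) * (F * Real.exp (-ν * (τ - t₀))) :=
          mul_le_mul (hflow _ (sub_nonneg.2 hτ.2)) (hf τ hτ.1.le) (norm_nonneg _)
            (by positivity)
      _ = C * F * (Real.exp (-μ * (t - τ)) * Real.exp (-ν * (τ - t₀))) := by ring
      _ = _ := by rw [← Real.exp_add, ← Real.exp_add]; ring_nf
  have hint : IntervalIntegrable (fun τ => matrixFlow H (t - τ) (f τ)) MeasureTheory.volume t₀ t := by
    refine (Continuous.intervalIntegrable (by fun_prop) _ _ : IntervalIntegrable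
      (fun τ => C * F * (Real.exp (-μ * t + ν * t₀) * Real.exp ((μ - ν) * τ)))
        MeasureTheory.volume t₀ t).mono_fun' ?_ ?_
    · exact (ContinuousLinearMap.id ℝ _).aestronglyMeasurable_comp₂
        hcf.aestronglyMeasurable.restrict (hfi t ht).aestronglyMeasurable_restrict_uIoc
    · rw [uIoc_of_le ht]
      exact (MeasureTheory.ae_restrict_mem measurableSet_Ioc).mono hbound
  have hftc := MeasureTheory.integral_eq_of_hasDerivAt_off_countable_of_le
    (fun τ => matrixFlow H (t - τ) (y τ)) (fun τ => matrixFlow H (t - τ) (f τ)) ht hS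
    (hcf.continuousOn.clm_apply (hy.mono fun x hx => hx.1))
    (fun x hx => hasDerivAt_matrixFlow_apply H (hd x hx.1.1 hx.2)) hint
  simp only [sub_self, matrixFlow_zero, one_apply_eq_self] at hftc
  have hprim : ∫ τ in t₀..t, C * F * (Real.exp (-μ * t + ν * t₀) * Real.exp ((μ - ν) * τ)) =
      C * F * (Real.exp (-μ * t + ν * t₀) *
        ((Real.exp ((μ - ν) * t) - Real.exp ((μ - ν) * t₀)) / (μ - ν))) := by
    rw [intervalIntegral.integral_const_mul, intervalIntegral.integral_const_mul]
    congr 2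
    rw [intervalIntegral.integral_comp_mul_left (a := t₀) (b := t) Real.exp hμν.ne', integral_exp,
      smul_eq_mul]
    field_simp
  -- The convolution of exp(-μτ) with exp(-ντ) is at most exp(-ν(t - t₀))/(μ - ν), after dropping
  -- the lower endpoint of the primitive.
  have hI : ‖∫ τ in t₀..t, matrixFlow H (t - τ) (f τ)‖ ≤
      C * (F / (μ - ν)) * Real.exp (-ν * (t - t₀)) := by
    have h1 : ‖∫ τ in t₀..t, matrixFlow H (t - τ) (f τ)‖ ≤
        ∫ τ in t₀..t, C * F * (Real.exp (-μ * t + ν * t₀) * Real.exp ((μ - ν) * τ)) := by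
      exact intervalIntegral.norm_integral_le_of_norm_le ht (MeasureTheory.ae_of_all _ hbound)
        (Continuous.intervalIntegrable (by fun_prop) _ _)
    refine h1.trans ?_
    rw [hprim]
    calc C * F * (Real.exp (-μ * t + ν * t₀) *
          ((Real.exp ((μ - ν) * t) - Real.exp ((μ - ν) * t₀)) / (μ - ν)))
        ≤ C * F * (Real.exp (-μ * t + ν * t₀) * (Real.exp ((μ - ν) * t) / (μ - ν))) := by
          have := Real.exp_pos ((μ - ν) * t₀)
          gcongr
          linarith
      _ = C * (F / (μ - ν)) * (Real.exp (-μ * t + ν * t₀) * Real.exp ((μ - ν) * t)) := by ring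
      _ = _ := by rw [← Real.exp_add]; ring_nf
  have hy0 : ‖matrixFlow H (t - t₀) (y t₀)‖ ≤ C * ‖y t₀‖ * Real.exp (-ν * (t - t₀)) := by
    calc ‖matrixFlow H (t - t₀) (y t₀)‖ ≤ ‖matrixFlow H (t - t₀)‖ * ‖y t₀‖ :=
          ContinuousLinearMap.le_opNorm _ _
      _ ≤ C * Real.exp (-ν * (t - t₀)) * ‖y t₀‖ := by
          gcongr
          refine (hflow _ (sub_nonneg.2 ht)).trans ?_
          gcongr C * Real.exp ?_
          nlinarith
      _ = _ := by ring
  have hyt : y t = matrixFlow H (t - t₀) (y t₀) + ∫ τ in t₀..t, matrixFlow H (t - τ) (f τ) := by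
    rw [hftc]; abel
  calc ‖y t‖ ≤ ‖matrixFlow H (t - t₀) (y t₀)‖ + ‖∫ τ in t₀..t, matrixFlow H (t - τ) (f τ)‖ := by
        conv_lhs => rw [hyt]
        exact norm_add_le _ _
    _ ≤ C * ‖y t₀‖ * Real.exp (-ν * (t - t₀)) +
        C * (F / (μ - ν)) * Real.exp (-ν * (t - t₀)) := add_le_add hy0 hI
    _ = _ := by ring

/-! ### Synchronization of the closed loop -/

namespace IsClosedLoopSolution

variable {N n m : ℕ} {A : Matrix (Fin n) (Fin n) ℝ} {B : Matrix (Fin n) (Fin m) ℝ}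
  {K : Matrix (Fin m) (Fin n) ℝ} {G : CommGraph N} {t₀ : ℝ} {x η : Fin N → ℝ → Fin n → ℝ}

/-- The difference of the agent and the controller states follows the uncontrolled dynamics with
diffusive coupling. -/
theorem hasDerivAt_sub (h : IsClosedLoopSolution A B K G t₀ x η) {t : ℝ} (ht : t₀ < t)
    (hL : ContinuousAt G.laplacian t) (k : Fin N) :
    HasDerivAt (fun τ => x k τ - η k τ) (A.mulVec (x k t - η k t) +
      ∑ j, G.weight t k j • ((x j t - η j t) - (x k t - η k t))) t := by
  refine ((h.deriv_x t ht hL k).sub (h.deriv_η t ht hL k)).congr_deriv ?_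
  have hsum : ∑ j, G.weight t k j • (η j t - η k t + x k t - x j t) =
      -∑ j, G.weight t k j • ((x j t - η j t) - (x k t - η k t)) := by
    rw [← Finset.sum_neg_distrib]
    refine Finset.sum_congr rfl fun j _ => ?_
    rw [← smul_neg]
    congr 1
    abel
  -- The input B K η_k enters both equations identically and cancels in the difference, leaving A
  -- acting on x_k - η_k.
  rw [hsum, Matrix.add_mulVec, Matrix.mulVec_sub, Matrix.mulVec_mulVec]
  abel

/-- Regrouping the coupling in terms of x - η exhibits η_k as a Hurwitz system whose forcing
vanishes as those signals synchronize. -/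
theorem hasDerivAt_η (h : IsClosedLoopSolution A B K G t₀ x η) {t : ℝ} (ht : t₀ < t)
    (hL : ContinuousAt G.laplacian t) (k : Fin N) :
    HasDerivAt (η k) ((A + B * K).mulVec (η k t) +
      -∑ j, G.weight t k j • ((x j t - η j t) - (x k t - η k t))) t := by
  refine (h.deriv_η t ht hL k).congr_deriv ?_
  rw [← Finset.sum_neg_distrib]
  congr 1
  refine Finset.sum_congr rfl fun j _ => ?_
  rw [← smul_neg]
  congr 1
  abel

/-- In the frame moving with the uncontrolled flow, each coordinate of `x - η` solves the scalar
consensus system. -/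
theorem isConsensusSolution (h : IsClosedLoopSolution A B K G t₀ x η) (ht₀ : 0 ≤ t₀)
    (hpc : PiecewiseContinuous G.laplacian) (i : Fin n) :
    IsConsensusSolution (fun t k j => G.weight t k j) (N * G.hi) t₀
      fun k t => matrixFlow A (t₀ - t) (x k t - η k t) i where
  nonneg t ht k j := G.weight_nonneg (ht₀.trans ht) k j
  sum_le t ht k := G.sum_weight_le (ht₀.trans ht) k
  integrable s t hs hst k j := G.intervalIntegrable_weight hpc (ht₀.trans hs) hst k j
  cont k := by
    have hc : Continuous fun τ => matrixFlow A (t₀ - τ) :=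
      (continuous_matrixFlow A).comp (continuous_const.sub continuous_id)
    exact (continuous_apply i).comp_continuousOn
      (hc.continuousOn.clm_apply ((h.continuousOn_x k).sub (h.continuousOn_η k)))
  deriv := by
    refine ⟨_, hpc.countable_discontinuityTimes, fun t ht htS k => ?_⟩
    have hL := continuousAt_of_notMem_discontinuityTimes (ht₀.trans_lt ht) htS
    refine (hasDerivAt_pi.1
      (hasDerivAt_matrixFlow_apply (c := t₀) A (h.hasDerivAt_sub ht hL k)) i).congr_deriv ?_
    simp only [map_sum, map_smul, map_sub, Finset.sum_apply, Pi.smul_apply, Pi.sub_apply,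
      smul_eq_mul]

end IsClosedLoopSolution

theorem CommGraph.norm_sum_weight_smul_le {N n : ℕ} (G : CommGraph N) {t : ℝ} (ht : 0 ≤ t)
    (k : Fin N) {v : Fin N → Fin n → ℝ} {c : ℝ} (hv : ∀ j, ‖v j‖ ≤ c) :
    ‖∑ j, G.weight t k j • v j‖ ≤ N * G.hi * c := by
  have hc : 0 ≤ c := (norm_nonneg _).trans (hv k)
  calc ‖∑ j, G.weight t k j • v j‖ ≤ ∑ j, G.weight t k j * c := by
        refine norm_sum_le_of_le _ fun j _ => ?_
        rw [norm_smul, Real.norm_of_nonneg (G.weight_nonneg ht k j)]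
        exact mul_le_mul_of_nonneg_left (hv j) (G.weight_nonneg ht k j)
    _ = (∑ j, G.weight t k j) * c := by rw [Finset.sum_mul]
    _ ≤ _ := mul_le_mul_of_nonneg_right (G.sum_weight_le ht k) hc

/-- The signals `x - η` synchronize exponentially to a solution of the uncontrolled system. -/
theorem exists_sync_rate_sub {N n m : ℕ} (A : Matrix (Fin n) (Fin n) ℝ)
    (B : Matrix (Fin n) (Fin m) ℝ) (K : Matrix (Fin m) (Fin n) ℝ) (G : CommGraph N)
    (hA : EigenvaluesInClosedLeftHalfPlane A) (hconn : G.UniformlyConnected)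
    (hpc : PiecewiseContinuous G.laplacian) :
    ∃ D ≥ 0, ∃ ν > 0, ∀ t₀ : ℝ, 0 ≤ t₀ → ∀ x η : Fin N → ℝ → Fin n → ℝ,
      IsClosedLoopSolution A B K G t₀ x η →
      ∃ x₀ : ℝ → Fin n → ℝ, (∀ t : ℝ, HasDerivAt x₀ (A.mulVec (x₀ t)) t) ∧
        ∀ t : ℝ, t₀ ≤ t → ∀ k : Fin N, ‖x k t - η k t - x₀ t‖ ≤
          D * Real.exp (-ν * (t - t₀)) * ∑ j, ‖x j t₀ - η j t₀ - x₀ t₀‖ := by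
  obtain ⟨T, hT, δ, hδ, r, hr⟩ := hconn
  have : Nonempty (Fin N) := ⟨r⟩
  have hreach : ∀ t₀, 0 ≤ t₀ → ReachesUniformly (fun t k j => G.weight t k j) T δ t₀ r :=
    fun t₀ ht₀ t ht j hj =>
      Relation.TransGen.mono (fun _ _ h => h.2) _ _ (hr t (ht₀.trans ht) j hj)
  obtain ⟨M, hM, lam, hlam, hcons⟩ := exists_consensus_rate (Fin N)
    (mul_nonneg (Nat.cast_nonneg N) G.hi_pos.le : (0 : ℝ) ≤ N * G.hi) hT hδ
  -- Eigenvalues on the imaginary axis may cause polynomial growth. Allowing the flow half the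
  -- consensus rate absorbs it and leaves the other half as decay.
  obtain ⟨C, hC, hflow⟩ := exists_norm_matrixFlow_le A (lam / 2) fun μ hμ =>
    (hA μ hμ).trans_lt (half_pos hlam)
  refine ⟨C * M, by positivity, lam / 2, half_pos hlam, fun t₀ ht₀ x η h => ?_⟩
  choose z₀ hz₀ using fun i => hcons _ t₀ _ r (h.isConsensusSolution ht₀ hpc i) (hreach t₀ ht₀)
  refine ⟨fun t => matrixFlow A (t - t₀) z₀, fun t => ?_, fun t ht k => ?_⟩
  · exact (hasDerivAt_matrixFlow_const A (t - t₀) z₀).comp_sub_const t t₀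
  · have hz : ‖matrixFlow A (t₀ - t) (x k t - η k t) - z₀‖ ≤
        M * Real.exp (-lam * (t - t₀)) * ∑ j, ‖x j t₀ - η j t₀ - z₀‖ := by
      -- Consensus constants are the same for all coordinates, so the sup norm assembles the scalar
      -- estimates without loss.
      refine (pi_norm_le_iff_of_nonneg (by positivity)).2 fun i => ?_
      refine (hz₀ i t ht k).trans ?_
      gcongr with j
      simpa [matrixFlow_zero] using norm_le_pi_norm (x j t₀ - η j t₀ - z₀) i
    have hs : x k t - η k t - matrixFlow A (t - t₀) z₀ =
        matrixFlow A (t - t₀) (matrixFlow A (t₀ - t) (x k t - η k t) - z₀) := by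
      have := matrixFlow_apply_neg A (t - t₀) (x k t - η k t)
      rw [neg_sub] at this
      rw [map_sub, this]
    simp only [sub_self, matrixFlow_zero, one_apply_eq_self]
    rw [hs]
    calc _ ≤ ‖matrixFlow A (t - t₀)‖ * ‖matrixFlow A (t₀ - t) (x k t - η k t) - z₀‖ :=
          ContinuousLinearMap.le_opNorm _ _
      _ ≤ (C * Real.exp (lam / 2 * (t - t₀))) *
          (M * Real.exp (-lam * (t - t₀)) * ∑ j, ‖x j t₀ - η j t₀ - z₀‖) :=
          mul_le_mul (hflow _ (sub_nonneg.2 ht)) hz (norm_nonneg _) (by positivity)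
      _ = C * M * (Real.exp (lam / 2 * (t - t₀)) * Real.exp (-lam * (t - t₀))) *
          ∑ j, ‖x j t₀ - η j t₀ - z₀‖ := by ring
      _ = _ := by
          rw [← Real.exp_add]
          congr 3
          ring

/-- Exponential synchronization of the closed loop, in the sup norm. -/
theorem exists_sync_rate {N n m : ℕ} (A : Matrix (Fin n) (Fin n) ℝ)
    (B : Matrix (Fin n) (Fin m) ℝ) (K : Matrix (Fin m) (Fin n) ℝ) (G : CommGraph N)
    (hA : EigenvaluesInClosedLeftHalfPlane A) (hK : IsHurwitz (A + B * K))
    (hconn : G.UniformlyConnected) (hpc : PiecewiseContinuous G.laplacian) :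
    ∃ M ≥ 0, ∃ lam > 0, ∀ t₀ : ℝ, 0 ≤ t₀ → ∀ x η : Fin N → ℝ → Fin n → ℝ,
      IsClosedLoopSolution A B K G t₀ x η →
      ∃ x₀ : ℝ → Fin n → ℝ, (∀ t : ℝ, HasDerivAt x₀ (A.mulVec (x₀ t)) t) ∧
        ∀ t : ℝ, t₀ ≤ t → ∀ k : Fin N, ‖x k t - x₀ t‖ + ‖η k t‖ ≤
          M * Real.exp (-lam * (t - t₀)) * ∑ j, (‖x j t₀ - x₀ t₀‖ + ‖η j t₀‖) := by
  obtain ⟨D, hD, ν₀, hν₀, hsync⟩ := exists_sync_rate_sub A B K G hA hconn hpc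
  obtain ⟨μ, hμ, hμH⟩ := exists_forall_eigenvalue_re_lt _ hK
  obtain ⟨C, hC, hflow⟩ := exists_norm_matrixFlow_le _ (-μ) hμH
  -- The common rate must not exceed that of the forcing and must stay strictly below μ, the decay
  -- rate of the Hurwitz flow.
  set ν := min ν₀ (μ / 2) with hν
  have hν0 : 0 < ν := lt_min hν₀ (half_pos hμ)
  have hνμ : ν < μ := (min_le_right _ _).trans_lt (half_lt_self hμ)
  have hμν : 0 < μ - ν := sub_pos.2 hνμ
  have hhi := G.hi_pos
  -- D controls x - η - x₀. The bound on η counts twice, once for itself and once inside x - x₀; 2D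
  -- bounds differences of two signals and N * hi the row sums.
  refine ⟨D + 2 * (C * (1 + N * G.hi * (2 * D) / (μ - ν))), by positivity, ν, hν0,
    fun t₀ ht₀ x η h => ?_⟩
  obtain ⟨x₀, hx₀, hs⟩ := hsync t₀ ht₀ x η h
  refine ⟨x₀, hx₀, fun t ht k => ?_⟩
  set R := ∑ j, (‖x j t₀ - x₀ t₀‖ + ‖η j t₀‖) with hR
  have hR0 : 0 ≤ R := by positivity
  have hs' : ∀ t, t₀ ≤ t → ∀ k,
      ‖x k t - η k t - x₀ t‖ ≤ D * R * Real.exp (-ν * (t - t₀)) := by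
    intro t ht k
    calc _ ≤ _ := hs t ht k
      _ ≤ D * Real.exp (-ν * (t - t₀)) * R := by
        gcongr
        · exact min_le_left _ _
        · rw [hR]
          gcongr with j
          rw [sub_right_comm]
          exact norm_sub_le _ _
      _ = _ := by ring
  have hdiff : ∀ t, t₀ ≤ t → ∀ k j, ‖(x j t - η j t) - (x k t - η k t)‖ ≤
      2 * (D * R * Real.exp (-ν * (t - t₀))) := by
    intro t ht k j
    calc _ = ‖(x j t - η j t - x₀ t) - (x k t - η k t - x₀ t)‖ := by congr 1; abel
      _ ≤ _ := norm_sub_le _ _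
      _ ≤ _ := by linarith [hs' t ht k, hs' t ht j]
  have hη : ‖η k t‖ ≤
      C * (‖η k t₀‖ + N * G.hi * (2 * (D * R)) / (μ - ν)) * Real.exp (-ν * (t - t₀)) := by
    refine norm_le_of_forced (A + B * K) hC (by positivity) hνμ hflow
      (f := fun t => -∑ j, G.weight t k j • ((x j t - η j t) - (x k t - η k t)))
      hpc.countable_discontinuityTimes (h.continuousOn_η k) (fun t ht htS => h.hasDerivAt_η ht
        (continuousAt_of_notMem_discontinuityTimes (ht₀.trans_lt ht) htS) k)
      (fun t ht => ?_) (fun t ht => ?_) ht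
    · have hsub : uIcc t₀ t ⊆ Ici t₀ := by
        rw [uIcc_of_le ht]; exact fun x hx => hx.1
      have := IntervalIntegrable.sum (μ := MeasureTheory.volume) (a := t₀) (b := t) Finset.univ
        (f := fun j τ => G.weight τ k j • ((x j τ - η j τ) - (x k τ - η k τ))) fun j _ =>
          (G.intervalIntegrable_weight hpc ht₀ ht k j).smul_continuousOn
            ((((h.continuousOn_x j).sub (h.continuousOn_η j)).sub
              ((h.continuousOn_x k).sub (h.continuousOn_η k))).mono hsub)
      rw [Finset.sum_fn] at this
      exact this.neg
    · rw [norm_neg]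
      refine (G.norm_sum_weight_smul_le (ht₀.trans ht) k (hdiff t ht k)).trans_eq ?_
      ring
  have hηR : ‖η k t₀‖ ≤ R :=
    (le_add_of_nonneg_left (norm_nonneg _)).trans
      (Finset.single_le_sum (f := fun j => ‖x j t₀ - x₀ t₀‖ + ‖η j t₀‖)
        (fun j _ => by positivity) (Finset.mem_univ k))
  have hη' : ‖η k t‖ ≤
      C * (R + N * G.hi * (2 * (D * R)) / (μ - ν)) * Real.exp (-ν * (t - t₀)) :=
    hη.trans (by gcongr)
  have hx : ‖x k t - x₀ t‖ ≤ ‖x k t - η k t - x₀ t‖ + ‖η k t‖ := by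
    calc _ = ‖(x k t - η k t - x₀ t) + η k t‖ := by congr 1; abel
      _ ≤ _ := norm_add_le _ _
  calc _ ≤ D * R * Real.exp (-ν * (t - t₀)) +
        2 * (C * (R + N * G.hi * (2 * (D * R)) / (μ - ν)) * Real.exp (-ν * (t - t₀))) := by
        linarith [hs' t ht k]
    _ = _ := by ring

theorem mainTheorem2 {N n m : ℕ} (A : Matrix (Fin n) (Fin n) ℝ)
    (B : Matrix (Fin n) (Fin m) ℝ) (K : Matrix (Fin m) (Fin n) ℝ) (G : CommGraph N)
    (hA : EigenvaluesInClosedLeftHalfPlane A)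
    (hAB : IsStabilizable A B)
    (hK : IsHurwitz (A + B * K))
    (hconn : G.UniformlyConnected)
    (hpc : PiecewiseContinuous G.laplacian)
    (hbd : ∃ C : ℝ, ∀ t : ℝ, 0 ≤ t → ∀ k j, |G.laplacian t k j| ≤ C) :
    ∃ M > 0, ∃ lam > 0, ∀ t₀ : ℝ, 0 ≤ t₀ → ∀ x η : Fin N → ℝ → Fin n → ℝ,
      IsClosedLoopSolution A B K G t₀ x η →
      ∃ x₀ : ℝ → Fin n → ℝ, (∀ t : ℝ, HasDerivAt x₀ (A.mulVec (x₀ t)) t) ∧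
        ∀ t : ℝ, t₀ ≤ t → ∀ k : Fin N,
          euclNorm (x k t - x₀ t) + euclNorm (η k t) ≤
            M * Real.exp (-lam * (t - t₀)) *
              ∑ j, (euclNorm (x j t₀ - x₀ t₀) + euclNorm (η j t₀)) := by
  obtain ⟨M, hM, lam, hlam, hsync⟩ := exists_sync_rate A B K G hA hK hconn hpc
  obtain ⟨c, hc, hle⟩ := exists_euclNorm_le n
  -- M is only known to be nonnegative, hence M + 1. Only the left side costs a factor c, as the sup
  -- norm is at most the Euclidean one.
  refine ⟨c * (M + 1), by positivity, lam, hlam, fun t₀ ht₀ x η h => ?_⟩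
  obtain ⟨x₀, hx₀, hs⟩ := hsync t₀ ht₀ x η h
  refine ⟨x₀, hx₀, fun t ht k => ?_⟩
  calc euclNorm (x k t - x₀ t) + euclNorm (η k t)
      ≤ c * (‖x k t - x₀ t‖ + ‖η k t‖) := by rw [mul_add]; exact add_le_add (hle _) (hle _)
    _ ≤ c * (M * Real.exp (-lam * (t - t₀)) * ∑ j, (‖x j t₀ - x₀ t₀‖ + ‖η j t₀‖)) := by
        gcongr
        exact hs t ht k
    _ ≤ c * ((M + 1) * Real.exp (-lam * (t - t₀)) *
          ∑ j, (euclNorm (x j t₀ - x₀ t₀) + euclNorm (η j t₀))) := by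
        gcongr with j
        · linarith
        · exact norm_le_euclNorm _
        · exact norm_le_euclNorm _
    _ = _ := by ring
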